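/- Let $d\ge 1$, $t\ge 0$ and $n\ge\binom{t+d-1}{d-1}$ be integers. Normalized vectors $\phi_1,\dots,\phi_n\in\mathbb{C}^d$ are said to form a spherical $t$-design if $$\frac1n\sum_{k=1}^n f(\phi_k)=\int f(\psi)\,\mathrm{d}\psi$$ for every $t$-th order polynomial function $f$ on $\mathbb{C}^d$, that is, every function of the form $f(\psi)=\langle\psi^{\otimes t}|F|\psi^{\otimes t}\rangle$ with $F$ a linear operator on the symmetric subspace of $(\mathbb{C}^d)^{\otimes t}$; the integral is over the unit sphere of $\mathbb{C}^d$ with respect to its normalized surface measure. Put $S_t=\sum_{k=1}^n|\phi_k^{\otimes t}\rangle\langle\phi_k^{\otimes t}|$. Then for all normalized vectors $\phi_1,\dots,\phi_n\in\mathbb{C}^d$ one has $\mathrm{Tr}[S_t^2]=\sum_{j,k}|\langle\phi_j|\phi_k\rangle|^{2t}$ (the $t$-th frame potential; $0^0=1$ if $t=0$), and $\{\phi_k\}_{k=1}^n$ forms a spherical $t$-design if and only if $$\sum_{j,k}|\langle\phi_j|\phi_k\rangle|^{2t}=\frac{n^2\,t!\,(d-1)!}{(t+d-1)!}.$$ Furthermore,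 this value is a lower bound for $\mathrm{Tr}[S_t^2]$ over all families of $n$ normalized vectors in $\mathbb{C}^d$, and it is the global minimum (i.e. it is attained) if and only if a spherical $t$-design of $n$ vectors exists in $\mathbb{C}^d$. -/

import Mathlib

noncomputable section

/-- The Hilbert space `ℂ^d`. -/
abbrev CSpace (d : ℕ) : Type := EuclideanSpace ℂ (Fin d)

/-- The unit sphere of `ℂ^d`, i.e. the normalized vectors. -/
abbrev USphere (d : ℕ) : Type := Metric.sphere (0 : CSpace d) 1

/-- The `t`-fold tensor power of `ℂ^d`, in coordinates with respect to the orthonormal product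
basis `e_{i 0} ⊗ ⋯ ⊗ e_{i (t-1)}`, indexed by `i : Fin t → Fin d`. -/
abbrev TensorSpace (d t : ℕ) : Type := EuclideanSpace ℂ (Fin t → Fin d)

/-- The vector `ψ ⊗ ⋯ ⊗ ψ` (`t` factors). -/
def tensorPow {d : ℕ} (t : ℕ) (ψ : CSpace d) : TensorSpace d t :=
  WithLp.toLp 2 (fun i => ∏ j, ψ (i j))

/-- The symmetric subspace of the `t`-fold tensor power: the vectors that are invariant under all
permutations of the tensor factors. -/
def symSubspace (d t : ℕ) : Submodule ℂ (TensorSpace d t) where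
  carrier := {v | ∀ (σ : Equiv.Perm (Fin t)) (i : Fin t → Fin d), v (i ∘ σ) = v i}
  add_mem' := by
    intro a b ha hb σ i
    simp [ha σ i, hb σ i]
  zero_mem' := by
    intro σ i
    simp
  smul_mem' := by
    intro c a ha σ i
    simp [ha σ i]

theorem tensorPow_mem_symSubspace {d : ℕ} (t : ℕ) (ψ : CSpace d) :
    tensorPow t ψ ∈ symSubspace d t := by
  intro σ i
  simpa [tensorPow] using Equiv.prod_comp σ (fun j => ψ (i j))

/-- `ψ ⊗ ⋯ ⊗ ψ` as an element of the symmetric subspace. -/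
def symPow {d : ℕ} (t : ℕ) (ψ : CSpace d) : symSubspace d t :=
  ⟨tensorPow t ψ, tensorPow_mem_symSubspace t ψ⟩

/-- `f` is a `t`-th order polynomial function on `ℂ^d`: it has the form
`f ψ = ⟨ψ^{⊗t}| F |ψ^{⊗t}⟩` for a linear operator `F` on the symmetric subspace. -/
def IsPolyOfOrder {d : ℕ} (t : ℕ) (f : CSpace d → ℂ) : Prop :=
  ∃ F : symSubspace d t →ₗ[ℂ] symSubspace d t,
    ∀ ψ : CSpace d, f ψ = inner ℂ (tensorPow t ψ) (F (symPow t ψ) : TensorSpace d t)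

/-- The average of `f` over all normalized vectors, with respect to the (normalized)
surface measure of the unit sphere. -/
def sphereAverage {d : ℕ} (f : CSpace d → ℂ) : ℂ :=
  ⨍ ψ : USphere d, f ψ ∂((MeasureTheory.volume : MeasureTheory.Measure (CSpace d)).toSphere)

/-- The normalized vectors `φ 0, …, φ (n-1)` form a complex spherical `t`-design. -/
def IsSphericalDesign {d n : ℕ} (t : ℕ) (φ : Fin n → USphere d) : Prop :=
  ∀ f : CSpace d → ℂ, IsPolyOfOrder t f →
    (∑ k, f (φ k)) / (n : ℂ) = sphereAverage f

/-- The operator `S_t = ∑ₖ |φₖ^{⊗t}⟩⟨φₖ^{⊗t}|`. -/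
def frameOp {d n : ℕ} (t : ℕ) (φ : Fin n → USphere d) :
    TensorSpace d t →L[ℂ] TensorSpace d t :=
  ∑ k, InnerProductSpace.rankOne ℂ (tensorPow t (φ k : CSpace d)) (tensorPow t (φ k : CSpace d))

/-- The `t`-th frame potential `∑_{j,k} |⟨φ_j|φ_k⟩|^{2t}`. -/
def framePotential {d n : ℕ} (t : ℕ) (φ : Fin n → USphere d) : ℝ :=
  ∑ j, ∑ k, ‖inner ℂ (φ j : CSpace d) (φ k : CSpace d)‖ ^ (2 * t)

/-- The number `n² t! (d-1)! / (t+d-1)!`, meant for `d ≥ 1`. -/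
def designBound (d t n : ℕ) : ℝ :=
  (n : ℝ) ^ 2 * (t.factorial : ℝ) * ((d - 1).factorial : ℝ) / ((t + d - 1).factorial : ℝ)

end

open MeasureTheory Set

/-! Send ψ to P(ψ) = |ψ^{⊗t}⟩⟨ψ^{⊗t}| in the Hilbert-Schmidt space. Then ⟨P(ψ), P(χ)⟩ =
|⟨ψ|χ⟩|^{2t}, and every t-th order polynomial is ψ ↦ ⟨G, P(ψ)⟩ for some G. Hence a family is a
design as soon as the defect M, the mean of the P(φ_k) minus the spherical mean of P, vanishes. The
spherical mean of |⟨x|ψ⟩|^{2t} is the same c = t!(d-1)!/(t+d-1)! for every unit x, so expanding ‖M‖²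
shows that the frame potential minus n²c is n²‖M‖² (`norm_sq_design_defect`). This gives both the
lower bound and the equality case.

The constant c (`average_norm_inner_pow`) comes from evaluating a Gaussian integral in Cartesian and
in polar coordinates. -/

/-! ### Moments of the unit sphere -/

/-- Integration in polar coordinates of a positively homogeneous function times a radial one. -/
theorem integral_homogeneous_mul_radial {E : Type*} [NormedAddCommGroup E] [NormedSpace ℝ E]
    [MeasurableSpace E] [BorelSpace E] [FiniteDimensional ℝ E] [Nontrivial E]
    (μ : Measure E) [μ.IsAddHaarMeasure] {m : ℕ} {F : E → ℝ}
    (hF : ∀ (r : ℝ) (x : E), 0 < r → F (r • x) = r ^ m * F x) (g : ℝ → ℝ) :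
    ∫ x, F x * g ‖x‖ ∂μ = (∫ ψ : Metric.sphere (0 : E) 1, F ψ ∂μ.toSphere) *
      ∫ r in Ioi (0 : ℝ), r ^ (Module.finrank ℝ E - 1) * (r ^ m * g r) := by
  calc
    ∫ x, F x * g ‖x‖ ∂μ = ∫ x : ({(0)}ᶜ : Set E), F x.1 * g (‖x.1‖) ∂(μ.comap (↑)) := by
      rw [integral_subtype_comap (measurableSet_singleton _).compl fun x ↦ F x * g (‖x‖),
        restrict_compl_singleton]
    _ = ∫ x, F x.1 * ((x.2 : ℝ) ^ m * g x.2)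
          ∂μ.toSphere.prod (.volumeIoiPow (Module.finrank ℝ E - 1)) := by
      rw [← μ.measurePreserving_homeomorphUnitSphereProd.integral_comp
        (Homeomorph.measurableEmbedding _)
        (fun x : Metric.sphere (0 : E) 1 × Ioi (0 : ℝ) => F x.1 * ((x.2 : ℝ) ^ m * g x.2))]
      refine integral_congr_ae (.of_forall fun x => ?_)
      have hx : 0 < ‖x.1‖ := norm_pos_iff.2 x.2
      have h := hF ‖x.1‖ (‖x.1‖⁻¹ • x.1) hx
      rw [smul_smul, mul_inv_cancel₀ hx.ne', one_smul] at h
      simp only [homeomorphUnitSphereProd_apply_snd_coe, homeomorphUnitSphereProd_apply_fst_coe]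
      rw [h]
      ring
    _ = (∫ ψ : Metric.sphere (0 : E) 1, F ψ ∂μ.toSphere) *
        ∫ x : Ioi (0 : ℝ), ((x : ℝ) ^ m * g x) ∂.volumeIoiPow (Module.finrank ℝ E - 1) :=
      integral_prod_mul (fun ψ : Metric.sphere (0 : E) 1 => F ψ)
        (fun x : Ioi (0 : ℝ) => (x : ℝ) ^ m * g x)
    _ = _ := by
      congr 1
      simp only [Measure.volumeIoiPow, ENNReal.ofReal]
      rw [integral_withDensity_eq_integral_smul,
        integral_subtype_comap measurableSet_Ioi
          fun a ↦ Real.toNNReal (a ^ (Module.finrank ℝ E - 1)) • (a ^ m * g a),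
        setIntegral_congr_fun measurableSet_Ioi fun x hx ↦ ?_]
      · rw [NNReal.smul_def, Real.coe_toNNReal _ (pow_nonneg hx.out.le _), smul_eq_mul]
      · exact (measurable_subtype_coe.pow_const _).real_toNNReal

theorem Complex.integral_norm_pow_mul_exp_neg_sq (m : ℕ) :
    ∫ z : ℂ, ‖z‖ ^ (2 * m) * Real.exp (-‖z‖ ^ 2) = Real.pi * m.factorial := by
  have h := Complex.integral_rpow_mul_exp_neg_rpow (p := 2) (q := ((2 * m : ℕ) : ℝ)) one_le_two
    (by linarith [Nat.cast_nonneg (α := ℝ) (2 * m)])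
  simp only [Real.rpow_natCast, Real.rpow_two] at h
  rw [h, ← Real.Gamma_nat_eq_factorial]
  push_cast
  rw [show (2 * (m : ℝ) + 2) / 2 = m + 1 by ring]
  ring

theorem integral_Ioi_pow_mul_exp_neg_sq {d : ℕ} (hd : 1 ≤ d) (m : ℕ) :
    ∫ r in Ioi (0 : ℝ), r ^ (2 * d - 1) * (r ^ (2 * m) * Real.exp (-r ^ 2)) =
      1 / 2 * (m + d - 1).factorial := by
  have h := _root_.integral_rpow_mul_exp_neg_rpow (p := 2) (q := ((2 * d - 1 + 2 * m : ℕ) : ℝ))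
    two_pos (by linarith [Nat.cast_nonneg (α := ℝ) (2 * d - 1 + 2 * m)])
  simp only [Real.rpow_natCast, Real.rpow_two, pow_add, mul_assoc] at h
  rw [h, ← Real.Gamma_nat_eq_factorial]
  -- Writing d = 1 + k removes the truncated subtractions.
  obtain ⟨k, rfl⟩ := Nat.exists_eq_add_of_le hd
  rw [show 2 * (1 + k) - 1 + 2 * m = 2 * (m + k) + 1 by omega, show m + (1 + k) - 1 = m + k by omega]
  push_cast
  congr 2
  ring

theorem exists_orthonormalBasis_apply_eq {d : ℕ} (hd : 1 ≤ d) (x : USphere d) :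
    ∃ (i : Fin d) (b : OrthonormalBasis (Fin d) ℂ (CSpace d)), b i = x := by
  have hx : ‖(x : CSpace d)‖ = 1 := by simp
  obtain ⟨b, hb⟩ := Orthonormal.exists_orthonormalBasis_extension_of_card_eq (𝕜 := ℂ)
    (E := CSpace d) (ι := Fin d) (by simp) (v := fun _ => (x : CSpace d)) (s := {⟨0, hd⟩})
    ⟨fun _ => hx, fun i j hij => (hij (Subsingleton.elim i j)).elim⟩
  exact ⟨⟨0, hd⟩, b, hb _ rfl⟩

/-- In an orthonormal basis containing x the integrand factors over the coordinates: one factor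
integrates to π m!, the others to π. `C` absorbs π^d and the Haar scaling; all that matters is that
it does not depend on m. -/
theorem gaussian_moment {d : ℕ} (hd : 1 ≤ d) (μ : Measure (CSpace d)) [μ.IsAddHaarMeasure]
    (x : USphere d) :
    ∃ C : ℝ, ∀ m : ℕ, ∫ z, ‖inner ℂ (x : CSpace d) z‖ ^ (2 * m) * Real.exp (-‖z‖ ^ 2) ∂μ =
      C * m.factorial := by
  obtain ⟨i₀, b, hb⟩ := exists_orthonormalBasis_apply_eq hd x
  let L : CSpace d ≃L[ℝ] (Fin d → ℂ) :=
    LinearEquiv.toContinuousLinearEquiv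
      ((b.repr.toLinearEquiv.trans (WithLp.linearEquiv 2 ℂ (Fin d → ℂ))).restrictScalars ℝ)
  have hL : ∀ z i, L z i = inner ℂ (b i) z := fun z i => b.repr_apply_apply z i
  have := L.isAddHaarMeasure_map μ
  have hmap := Measure.isAddLeftInvariant_eq_smul (μ.map L) (volume : Measure (Fin d → ℂ))
  set s := (μ.map L).addHaarScalarFactor (volume : Measure (Fin d → ℂ))
  refine ⟨s * Real.pi ^ d, fun m => ?_⟩
  have key : ∀ z, ‖inner ℂ (x : CSpace d) z‖ ^ (2 * m) * Real.exp (-‖z‖ ^ 2) =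
      ∏ i, (‖L z i‖ ^ (if i = i₀ then 2 * m else 0) * Real.exp (-‖L z i‖ ^ 2)) := by
    intro z
    rw [Finset.prod_mul_distrib, ← Real.exp_sum, Finset.sum_neg_distrib]
    simp only [hL]
    rw [← b.sum_sq_norm_inner_right z]
    simp [pow_ite, hb]
  simp_rw [key]
  have hemb : MeasurableEmbedding L := L.toHomeomorph.measurableEmbedding
  rw [← hemb.integral_map (fun y : Fin d → ℂ => ∏ i, (‖y i‖ ^ (if i = i₀ then 2 * m else 0) * Real.exp (-‖y i‖ ^ 2)))]
  rw [hmap, integral_smul_nnreal_measure, integral_fintype_prod_volume_eq_prod (𝕜 := ℝ)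
    (fun i (w : ℂ) => ‖w‖ ^ (if i = i₀ then 2 * m else 0) * Real.exp (-‖w‖ ^ 2))]
  have h3 : ∀ i : Fin d, ∫ w : ℂ, ‖w‖ ^ (if i = i₀ then 2 * m else 0) * Real.exp (-‖w‖ ^ 2) =
      Real.pi * (if i = i₀ then m.factorial else 1 : ℕ) := by
    intro i
    split_ifs
    · exact Complex.integral_norm_pow_mul_exp_neg_sq m
    · simpa using Complex.integral_norm_pow_mul_exp_neg_sq 0
  simp_rw [h3]
  rw [Finset.prod_mul_distrib]
  simp [NNReal.smul_def, mul_assoc]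

/-- The average of `|⟨x|ψ⟩|^{2t}` over the unit sphere. -/
theorem average_norm_inner_pow {d : ℕ} (hd : 1 ≤ d) (μ : Measure (CSpace d)) [μ.IsAddHaarMeasure]
    (t : ℕ) (x : USphere d) :
    ⨍ ψ : USphere d, ‖inner ℂ (x : CSpace d) (ψ : CSpace d)‖ ^ (2 * t) ∂μ.toSphere =
      (t.factorial : ℝ) * (d - 1).factorial / (t + d - 1).factorial := by
  have : Nonempty (Fin d) := ⟨⟨0, hd⟩⟩
  obtain ⟨C, hC⟩ := gaussian_moment hd μ x
  have hdim : Module.finrank ℝ (CSpace d) = 2 * d := by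
    rw [finrank_real_of_complex, finrank_euclideanSpace_fin]
  have key : ∀ m : ℕ,
      (∫ ψ : USphere d, ‖inner ℂ (x : CSpace d) (ψ : CSpace d)‖ ^ (2 * m) ∂μ.toSphere) *
        (1 / 2 * (m + d - 1).factorial) = C * m.factorial := by
    intro m
    rw [← hC m, ← integral_Ioi_pow_mul_exp_neg_sq hd m, ← hdim]
    refine (integral_homogeneous_mul_radial μ (m := 2 * m)
      (F := fun z => ‖inner ℂ (x : CSpace d) z‖ ^ (2 * m)) (fun r z hr => ?_)
      (fun r => Real.exp (-r ^ 2))).symm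
    rw [inner_smul_right_eq_smul, norm_smul, mul_pow, Real.norm_of_nonneg hr.le]
  -- The case m = 0 gives the total mass of the sphere; dividing by it eliminates `C`.
  have h0 := key 0
  have ht := key t
  simp only [mul_zero, pow_zero, integral_const, smul_eq_mul, mul_one, Nat.factorial_zero,
    Nat.cast_one, zero_add] at h0
  have hA : μ.toSphere.real univ ≠ 0 := by
    rw [Measure.real, ENNReal.toReal_ne_zero]
    exact ⟨Measure.measure_univ_ne_zero.2 μ.toSphere_ne_zero, measure_ne_top _ _⟩
  have hf : ((t + d - 1).factorial : ℝ) ≠ 0 := by positivity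
  rw [average_eq, smul_eq_mul]
  rw [← h0] at ht
  field_simp at ht ⊢
  linarith

/-! ### Tensor powers and polynomial functions -/

theorem inner_tensorPow {d : ℕ} (t : ℕ) (ψ χ : CSpace d) :
    inner ℂ (tensorPow t ψ) (tensorPow t χ) = inner ℂ ψ χ ^ t := by
  simp only [tensorPow, PiLp.inner_apply, RCLike.inner_apply, map_prod, ← Finset.prod_mul_distrib]
  rw [Finset.sum_pow', Fintype.piFinset_univ]

theorem trace_frameOp_sq {d n : ℕ} (t : ℕ) (φ : Fin n → USphere d) :
    LinearMap.trace ℂ (TensorSpace d t) ((frameOp t φ * frameOp t φ :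
      TensorSpace d t →L[ℂ] TensorSpace d t) : TensorSpace d t →ₗ[ℂ] TensorSpace d t)
      = (framePotential t φ : ℂ) := by
  simp only [frameOp, framePotential, Finset.sum_mul_sum, ContinuousLinearMap.mul_def,
    InnerProductSpace.rankOne_comp_rankOne, ContinuousLinearMap.toLinearMap_sum,
    ContinuousLinearMap.toLinearMap_smul, map_sum, map_smul, InnerProductSpace.trace_rankOne,
    Complex.ofReal_sum, Complex.ofReal_pow, smul_eq_mul]
  refine Finset.sum_congr rfl fun j _ => Finset.sum_congr rfl fun k _ => ?_
  rw [inner_tensorPow, inner_tensorPow, ← mul_pow, ← inner_conj_symm (φ k : CSpace d),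
    Complex.mul_conj, Complex.normSq_eq_norm_sq]
  push_cast
  ring

/-- The matrix of `|ψ^{⊗t}⟩⟨ψ^{⊗t}|`, as a vector of the Hilbert-Schmidt space. -/
def tensorProj {d : ℕ} (t : ℕ) (ψ : CSpace d) :
    EuclideanSpace ℂ ((Fin t → Fin d) × (Fin t → Fin d)) :=
  WithLp.toLp 2 fun p => tensorPow t ψ p.1 * star (tensorPow t ψ p.2)

theorem inner_tensorProj {d : ℕ} (t : ℕ) (ψ χ : CSpace d) :
    inner ℂ (tensorProj t ψ) (tensorProj t χ) = ((‖inner ℂ ψ χ‖ ^ (2 * t) : ℝ) : ℂ) := by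
  have h : inner ℂ (tensorProj t ψ) (tensorProj t χ) =
      inner ℂ (tensorPow t ψ) (tensorPow t χ) * star (inner ℂ (tensorPow t ψ) (tensorPow t χ)) := by
    simp only [tensorProj, PiLp.inner_apply, RCLike.inner_apply, star_sum, Finset.sum_mul_sum,
      Fintype.sum_prod_type]
    refine Finset.sum_congr rfl fun j _ => Finset.sum_congr rfl fun k _ => ?_
    simp
    ring
  rw [h, inner_tensorPow, Complex.star_def, Complex.mul_conj, Complex.normSq_eq_norm_sq, norm_pow]
  push_cast
  ring

theorem continuous_tensorProj {d : ℕ} (t : ℕ) :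
    Continuous (tensorProj t : CSpace d → EuclideanSpace ℂ ((Fin t → Fin d) × (Fin t → Fin d))) := by
  unfold tensorProj tensorPow
  fun_prop

theorem IsPolyOfOrder.exists_inner_tensorProj {d t : ℕ} {f : CSpace d → ℂ}
    (hf : IsPolyOfOrder t f) :
    ∃ G : EuclideanSpace ℂ ((Fin t → Fin d) × (Fin t → Fin d)),
      ∀ ψ, f ψ = inner ℂ G (tensorProj t ψ) := by
  obtain ⟨F, hF⟩ := hf
  obtain ⟨H, hH⟩ := LinearMap.exists_extend ((symSubspace d t).subtype ∘ₗ F)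
  -- The inner product is conjugate-linear in its first slot, so `G` holds the conjugated matrix
  -- entries of an extension `H` of `F` to the whole tensor space.
  refine ⟨WithLp.toLp 2 fun p => star (H (EuclideanSpace.single p.1 1) p.2), fun ψ => ?_⟩
  have h1 : (F (symPow t ψ) : TensorSpace d t) = H (tensorPow t ψ) :=
    (LinearMap.congr_fun hH (symPow t ψ)).symm
  have h2 : H (tensorPow t ψ) =
      ∑ i, tensorPow t ψ i • H (EuclideanSpace.single i 1) := by
    conv_lhs => rw [← (EuclideanSpace.basisFun _ ℂ).sum_repr (tensorPow t ψ)]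
    simp
  rw [hF, h1, h2, inner_sum, PiLp.inner_apply, Fintype.sum_prod_type]
  refine Finset.sum_congr rfl fun i _ => ?_
  rw [inner_smul_right, PiLp.inner_apply, Finset.mul_sum]
  refine Finset.sum_congr rfl fun j _ => ?_
  simp [tensorProj]
  ring

/-- Take `F` to be |x^{⊗t}⟩⟨x^{⊗t}|. Testing a design on these functions, with x = φ_j, already
determines its frame potential. -/
theorem isPolyOfOrder_norm_inner_pow {d : ℕ} (t : ℕ) (x : CSpace d) :
    IsPolyOfOrder t fun ψ => ((‖inner ℂ x ψ‖ ^ (2 * t) : ℝ) : ℂ) := by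
  refine ⟨((innerSL ℂ (tensorPow t x)).toLinearMap ∘ₗ (symSubspace d t).subtype).smulRight
    (symPow t x), fun ψ => ?_⟩
  have h : inner ℂ (tensorPow t ψ) (inner ℂ (tensorPow t x) (tensorPow t ψ) • tensorPow t x) =
      ((‖inner ℂ x ψ‖ ^ (2 * t) : ℝ) : ℂ) := by
    rw [inner_smul_right, inner_tensorPow, inner_tensorPow, ← inner_conj_symm ψ x, ← mul_pow,
      Complex.mul_conj, Complex.normSq_eq_norm_sq]
    push_cast
    ring
  exact h.symm

/-! ### The design defect and the bound -/

/-- The squared distance between an empirical mean and the mean embedding, when the kernel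
`⟨T x, T y⟩` has the constant mean `c` in each variable. -/
theorem norm_sq_sum_sub_integral {X W : Type*} [MeasurableSpace X] [NormedAddCommGroup W]
    [InnerProductSpace ℂ W] [CompleteSpace W] (ν : Measure X) [IsProbabilityMeasure ν]
    {T : X → W} (hT : Integrable T ν) {c : ℝ}
    (hc : ∀ x, ∫ y, inner ℂ (T x) (T y) ∂ν = (c : ℂ)) {n : ℕ} (hn : n ≠ 0) (φ : Fin n → X) :
    ((‖(n : ℂ)⁻¹ • ∑ k, T (φ k) - ∫ y, T y ∂ν‖ ^ 2 : ℝ) : ℂ) =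
      ((n : ℂ) ^ 2)⁻¹ * (∑ j, ∑ k, inner ℂ (T (φ j)) (T (φ k))) - c := by
  have h1 : ∀ x, inner ℂ (T x) (∫ y, T y ∂ν) = (c : ℂ) := fun x => by
    rw [← integral_inner hT, hc]
  have h2 : ∀ x, inner ℂ (∫ y, T y ∂ν) (T x) = (c : ℂ) := fun x => by
    rw [← inner_conj_symm, h1, Complex.conj_ofReal]
  -- Both cross terms and the squared norm of the mean equal c, so -2c + c leaves -c.
  have h3 : inner ℂ (∫ y, T y ∂ν) (∫ y, T y ∂ν) = (c : ℂ) := by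
    rw [← integral_inner hT]
    simp [h2]
  have hn' : (n : ℂ) ≠ 0 := Nat.cast_ne_zero.2 hn
  rw [Complex.ofReal_pow]
  refine (inner_self_eq_norm_sq_to_K (𝕜 := ℂ) (E := W) _).symm.trans ?_
  simp only [inner_sub_left, inner_sub_right, inner_smul_left, inner_smul_right, sum_inner,
    inner_sum, h1, h2, h3, Finset.sum_const, Finset.card_univ, Fintype.card_fin, nsmul_eq_mul,
    map_inv₀, map_natCast]
  rw [Finset.sum_sub_distrib, ← Finset.mul_sum, Finset.sum_comm, Finset.sum_const,
    Finset.card_univ, Fintype.card_fin, nsmul_eq_mul]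
  field_simp
  ring

theorem sphereAverage_norm_inner_pow {d : ℕ} (hd : 1 ≤ d) (t : ℕ) (x : USphere d) :
    sphereAverage (fun ψ => ((‖inner ℂ (x : CSpace d) ψ‖ ^ (2 * t) : ℝ) : ℂ)) =
      (((t.factorial : ℝ) * (d - 1).factorial / (t + d - 1).factorial : ℝ) : ℂ) := by
  rw [sphereAverage, ← average_norm_inner_pow hd volume t x, average_eq, average_eq,
    integral_complex_ofReal, smul_eq_mul, Complex.real_smul, Complex.ofReal_mul]

/-- The defect of a spherical `t`-design, as a vector of the Hilbert-Schmidt space. -/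
theorem norm_sq_design_defect {d n : ℕ} (hd : 1 ≤ d) (hn : n ≠ 0) (t : ℕ)
    (φ : Fin n → USphere d) :
    ∃ M : EuclideanSpace ℂ ((Fin t → Fin d) × (Fin t → Fin d)),
      framePotential t φ - designBound d t n = n ^ 2 * ‖M‖ ^ 2 ∧
      ∀ G, (∑ k, inner ℂ G (tensorProj t (φ k : CSpace d))) / (n : ℂ) -
        sphereAverage (fun ψ => inner ℂ G (tensorProj t ψ)) = inner ℂ G M := by
  have : Nonempty (Fin d) := ⟨⟨0, hd⟩⟩
  have : NeZero (volume : Measure (CSpace d)).toSphere := ⟨Measure.toSphere_ne_zero _⟩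
  let ν : Measure (USphere d) :=
    ((volume : Measure (CSpace d)).toSphere univ)⁻¹ • (volume : Measure (CSpace d)).toSphere
  have : IsProbabilityMeasure ν := isProbabilityMeasureSMul
  have hT : Integrable (fun ψ : USphere d => tensorProj t (ψ : CSpace d)) ν :=
    ((continuous_tensorProj t).comp continuous_subtype_val).integrable_of_hasCompactSupport
      (HasCompactSupport.of_compactSpace _)
  have hc := fun x : USphere d => sphereAverage_norm_inner_pow hd t x
  simp only [← inner_tensorProj] at hc
  have hn' : (n : ℝ) ≠ 0 := Nat.cast_ne_zero.2 hn
  refine ⟨(n : ℂ)⁻¹ • ∑ k, tensorProj t (φ k : CSpace d) - ∫ ψ, tensorProj t (ψ : CSpace d) ∂ν,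
    ?_, fun G => ?_⟩
  · have h := norm_sq_sum_sub_integral ν hT hc hn φ
    simp only [inner_tensorProj] at h
    have hr := Complex.ofReal_injective (a₂ := ((n : ℝ) ^ 2)⁻¹ * framePotential t φ -
      (t.factorial : ℝ) * (d - 1).factorial / (t + d - 1).factorial)
      (h.trans (by simp [framePotential]))
    rw [hr, designBound]
    field_simp
  · rw [inner_sub_right, inner_smul_right, inner_sum, ← integral_inner hT, div_eq_inv_mul]
    -- The average `⨍` is by definition the integral against `ν`.
    rfl

theorem isSphericalDesign_iff_framePotential_eq {d n : ℕ} (hd : 1 ≤ d) (hn : n ≠ 0) (t : ℕ)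
    (φ : Fin n → USphere d) :
    IsSphericalDesign t φ ↔ framePotential t φ = designBound d t n := by
  constructor
  · intro h
    have hn' : (n : ℝ) ≠ 0 := Nat.cast_ne_zero.2 hn
    have hj : ∀ j, ∑ k, ‖inner ℂ (φ j : CSpace d) (φ k : CSpace d)‖ ^ (2 * t) =
        n * ((t.factorial : ℝ) * (d - 1).factorial / (t + d - 1).factorial) := by
      intro j
      have hj := h _ (isPolyOfOrder_norm_inner_pow t (φ j : CSpace d))
      rw [sphereAverage_norm_inner_pow hd] at hj
      have hj' : (∑ k, ‖inner ℂ (φ j : CSpace d) (φ k : CSpace d)‖ ^ (2 * t)) / (n : ℝ) =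
          (t.factorial : ℝ) * (d - 1).factorial / (t + d - 1).factorial := by
        exact_mod_cast hj
      rw [← hj']
      field_simp
    simp only [framePotential, hj, designBound, Finset.sum_const, Finset.card_univ,
      Fintype.card_fin, nsmul_eq_mul]
    ring
  · intro h f hf
    obtain ⟨M, hM, hG⟩ := norm_sq_design_defect hd hn t φ
    obtain ⟨G, hf⟩ := hf.exists_inner_tensorProj
    rw [h, sub_self, zero_eq_mul] at hM
    have hM0 : M = 0 := by simpa [hn] using hM
    have := hG G
    rw [hM0, inner_zero_right, sub_eq_zero] at this
    rw [show f = fun ψ => inner ℂ G (tensorProj t ψ) from funext hf]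
    exact this

theorem designBound_le_framePotential {d n : ℕ} (hd : 1 ≤ d) (hn : n ≠ 0) (t : ℕ)
    (φ : Fin n → USphere d) : designBound d t n ≤ framePotential t φ := by
  obtain ⟨M, hM, -⟩ := norm_sq_design_defect hd hn t φ
  rw [← sub_nonneg, hM]
  positivity

theorem theorem2 (d t n : ℕ) (hd : 1 ≤ d) (hn : (t + d - 1).choose (d - 1) ≤ n) :
    (∀ φ : Fin n → USphere d,
      LinearMap.trace ℂ (TensorSpace d t) ((frameOp t φ * frameOp t φ :
          TensorSpace d t →L[ℂ] TensorSpace d t) : TensorSpace d t →ₗ[ℂ] TensorSpace d t)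
        = (framePotential t φ : ℂ) ∧
      (IsSphericalDesign t φ ↔ framePotential t φ = designBound d t n) ∧
      designBound d t n ≤ framePotential t φ) ∧
    (IsLeast (Set.range fun φ : Fin n → USphere d => framePotential t φ) (designBound d t n) ↔
      ∃ φ : Fin n → USphere d, IsSphericalDesign t φ) := by
  -- The binomial coefficient is positive, so division by n is legitimate.
  have hn0 : n ≠ 0 :=
    ((Nat.choose_pos (show d - 1 ≤ t + d - 1 by omega)).trans_le hn).ne'
  refine ⟨fun φ => ⟨trace_frameOp_sq t φ, isSphericalDesign_iff_framePotential_eq hd hn0 t φ,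
    designBound_le_framePotential hd hn0 t φ⟩, ?_⟩
  simp only [isSphericalDesign_iff_framePotential_eq hd hn0]
  refine ⟨fun h => h.1, fun h => ⟨h, ?_⟩⟩
  rintro _ ⟨φ, rfl⟩
  exact designBound_le_framePotential hd hn0 t φ
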